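/- Let $\Sigma$ be a finite totally ordered alphabet, let $k \ge 2$ be an integer, and let $\mathbf{x} = a_0 a_1 a_2 \cdots$ be an infinite word over $\Sigma$. Suppose that (i) $\mathbf{x}$ is $k$-automatic, i.e. there is a deterministic finite automaton with outputs associated with its states that, for every $n \ge 0$, on input the base-$k$ representation of $n$ reaches a state with output $a_n$; and (ii) $\mathbf{x}$ is primitive morphic, i.e. $\mathbf{x} = \tau(h^{\omega}(a))$, where $A$ is a finite alphabet, $a \in A$, $\tau \colon A \to \Sigma$ is a letter-to-letter map, $h \colon A^* \to A^*$ is a primitive morphism (for some $n \ge 1$, every letter of $A$ occurs in $h^n(b)$ for every $b \in A$) that is prolongable on $a$ (that is, $h(a) = au$ with $h^n(u) \neq \epsilon$ for all $n \ge 0$), and $h^{\omega}(a) = \lim_{n\to\infty} h^n(a)$. Let $\rho^L_{\mathbf{x}}(n)$ denote the number of distinct length-$n$ factors of $\mathbf{x}$ that are Lyndon words, where a word is Lyndon if it is nonempty, is not of the form $u^m$ with $m \ge 2$, and is lexicographically least among all its conjugates (cyclic rotations). Then the sequence $(\rho^L_{\mathbf{x}}(n))_{n \ge 0}$ (the Lyndon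 complexity of $\mathbf{x}$) is $k$-automatic. -/

import Mathlib

namespace Word

/-! ### Finite words (lists) -/

/-- A word is a power if it equals `u ^ k` for some word `u` and some integer `k ≥ 2`. -/
def IsPower {α : Type*} (w : List α) : Prop :=
  ∃ (u : List α) (k : ℕ), 2 ≤ k ∧ w = (List.replicate k u).flatten

/-- A word is primitive if it is nonempty and not a power. -/
def IsPrimitive {α : Type*} (w : List α) : Prop :=
  w ≠ [] ∧ ¬ IsPower w

/-- A word is Lyndon if it is primitive and lexicographically least among all its conjugates.
The order on `List α` is the lexicographic one, in which a proper prefix is smaller;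
`w ~r v` says that `v` is a conjugate (cyclic rotation) of `w`. -/
def IsLyndon {α : Type*} [LinearOrder α] (w : List α) : Prop :=
  IsPrimitive w ∧ ∀ v : List α, List.IsRotated w v → w ≤ v

/-! ### Factors of infinite words and Lyndon complexity -/

/-- The length-`n` factor of the infinite word `x` that begins at position `i`. -/
def factor {α : Type*} (x : ℕ → α) (i n : ℕ) : List α :=
  List.ofFn (fun j : Fin n => x (i + j))

/-- The number of distinct Lyndon words that occur in `x` as factors of length `n`. -/
noncomputable def lyndonComplexity {α : Type*} [LinearOrder α] (x : ℕ → α) (n : ℕ) : ℕ :=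
  Set.ncard {w : List α | (∃ i : ℕ, w = factor x i n) ∧ IsLyndon w}

/-! ### Automatic sequences -/

/-- The base-`k` representation of `n`, most significant digit first and without leading zeros
(so that `0` is represented by the empty word), as a word over the digits `0, …, k - 1`. -/
def baseRep (k : ℕ) (hk : 2 ≤ k) (n : ℕ) : List (Fin k) :=
  (Nat.digits k n).reverse.pmap (fun d hd => (⟨d, hd⟩ : Fin k))
    (fun _ hd => Nat.digits_lt_base hk (List.mem_reverse.mp hd))

/-- A deterministic automaton with output: input digits `0, …, k - 1`, states `σ`, outputs `Δ`. -/
structure DFAO (k : ℕ) (σ : Type*) (Δ : Type*) where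
  /-- transition function -/
  step : σ → Fin k → σ
  /-- initial state -/
  start : σ
  /-- output associated with each state -/
  out : σ → Δ

/-- The output of the state that is reached from the initial state on the input `w`. -/
def DFAO.eval {k : ℕ} {σ Δ : Type*} (M : DFAO k σ Δ) (w : List (Fin k)) : Δ :=
  M.out (w.foldl M.step M.start)

/-- A sequence is `k`-automatic if some automaton with output and finitely many states maps
the base-`k` representation of every `n` to the `n`-th term of the sequence. -/
def IsAutomatic (k : ℕ) (hk : 2 ≤ k) {Δ : Type*} (x : ℕ → Δ) : Prop :=
  ∃ (σ : Type) (_ : Finite σ) (M : DFAO k σ Δ), ∀ n : ℕ, M.eval (baseRep k hk n) = x n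

/-! ### Primitive morphic sequences -/

/-- The endomorphism of the free monoid `A*` that extends a map `h` from letters to words. -/
def morph {A : Type*} (h : A → List A) (w : List A) : List A :=
  w.flatMap h

/-- A morphism `h` is primitive if, for some `n ≥ 1`, every letter occurs in the image of every
letter under the `n`-th power of `h`. -/
def IsPrimitiveMorphism {A : Type*} (h : A → List A) : Prop :=
  ∃ n : ℕ, 1 ≤ n ∧ ∀ a b : A, b ∈ (morph h)^[n] [a]

/-- A morphism `h` is prolongable on the letter `a` if `h(a) = a u` for some word `u` that no
power of `h` maps to the empty word. -/
def IsProlongable {A : Type*} (h : A → List A) (a : A) : Prop :=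
  ∃ u : List A, h a = a :: u ∧ ∀ n : ℕ, (morph h)^[n] u ≠ []

/-- The infinite word `y` is the limit of the finite words `w 0, w 1, …`: for each position, all
but finitely many of the `w n` carry there the letter of `y`. -/
def IsLimit {A : Type*} (w : ℕ → List A) (y : ℕ → A) : Prop :=
  ∀ i : ℕ, ∀ᶠ n in Filter.atTop, (w n)[i]? = some (y i)

/-- A sequence is primitive morphic if it is the image, under a letter-to-letter map `τ`, of the
limit of the words `h^n(a)`, where `h` is a primitive morphism over a finite alphabet
that is prolongable on the letter `a`. -/
def IsPrimitiveMorphic {B : Type*} (x : ℕ → B) : Prop :=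
  ∃ (A : Type) (_ : Finite A) (h : A → List A) (a : A) (τ : A → B) (y : ℕ → A),
    IsPrimitiveMorphism h ∧ IsProlongable h a ∧
      IsLimit (fun n => (morph h)^[n] [a]) y ∧ ∀ i : ℕ, x i = τ (y i)

end Word

/-! Two facts combine: for each fixed `c`, the statement "at least `c` Lyndon factors have length
`n`" is decidable by a finite automaton, and for linearly recurrent words the count is bounded. For
the first, predicates with a finite `k`-kernel are closed under Boolean operations, quantification
over ℕ and substitution of sums. Being Lyndon is expressible in these terms (`isLyndon_factor_iff`),
so being the first occurrence of a Lyndon factor is too, and fixed thresholds on the number of such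
occurrences follow by induction (`le_count_succ_iff`). For the second, primitive morphic words are
linearly recurrent (`isLinearlyRecurrent_of_isLimit`), and in a non-periodic linearly recurrent word
Lyndon factors of length `n` start at positions a constant fraction of `n` apart
(`lt_mul_sub_of_isLyndon_factor`), while every factor occurs in a prefix of length `R * n`. A
bounded sequence is determined by finitely many thresholds, hence is automatic. -/

namespace Word

/-! ### Finite kernels and their closure under first-order operations. -/

/-- A function of a vector of natural numbers has a finite `k`-kernel if it belongs to a finite
family of functions that is closed under the substitutions `v ↦ k * v + r`, where `r` is a vector
of digits. -/
def HasFiniteKernel (k : ℕ) {ι Δ : Type*} (f : (ι → ℕ) → Δ) : Prop :=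
  ∃ F : Set ((ι → ℕ) → Δ), F.Finite ∧ f ∈ F ∧
    ∀ g ∈ F, ∀ r : ι → Fin k, (fun v => g (fun i => k * v i + r i)) ∈ F

namespace HasFiniteKernel

variable {k : ℕ} {ι κ Δ Δ' Δ'' : Type*}

theorem map {f : (ι → ℕ) → Δ} (hf : HasFiniteKernel k f) (φ : Δ → Δ') :
    HasFiniteKernel k (fun v => φ (f v)) := by
  obtain ⟨F, hF, hfF, hcl⟩ := hf
  refine ⟨(fun g v => φ (g v)) '' F, hF.image _, ⟨f, hfF, rfl⟩, ?_⟩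
  rintro _ ⟨g, hg, rfl⟩ r
  exact ⟨_, hcl g hg r, rfl⟩

theorem map₂ {f : (ι → ℕ) → Δ} {g : (ι → ℕ) → Δ'} (hf : HasFiniteKernel k f)
    (hg : HasFiniteKernel k g) (φ : Δ → Δ' → Δ'') :
    HasFiniteKernel k (fun v => φ (f v) (g v)) := by
  obtain ⟨F, hF, hfF, hFcl⟩ := hf
  obtain ⟨G, hG, hgG, hGcl⟩ := hg
  refine ⟨Set.image2 (fun f g v => φ (f v) (g v)) F G, hF.image2 _ hG, ⟨f, hfF, g, hgG, rfl⟩, ?_⟩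
  rintro _ ⟨f', hf', g', hg', rfl⟩ r
  exact ⟨_, hFcl f' hf' r, _, hGcl g' hg' r, rfl⟩

theorem pi {C : Type*} [Finite C] {f : C → (ι → ℕ) → Δ} (hf : ∀ c, HasFiniteKernel k (f c)) :
    HasFiniteKernel k (fun v c => f c v) := by
  choose F hF hfF hcl using hf
  refine ⟨(fun (g : C → (ι → ℕ) → Δ) v c => g c v) '' Set.pi Set.univ F,
    (Set.Finite.pi hF).image _,
    ⟨f, fun c _ => hfF c, rfl⟩, ?_⟩
  rintro _ ⟨g, hg, rfl⟩ r
  exact ⟨fun c v => g c (fun i => k * v i + r i), fun c _ => hcl c (g c) (hg c trivial) r, rfl⟩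

theorem reindex {f : (ι → ℕ) → Δ} (hf : HasFiniteKernel k f) (σ : ι → κ) :
    HasFiniteKernel k (fun v : κ → ℕ => f (fun i => v (σ i))) := by
  obtain ⟨F, hF, hfF, hcl⟩ := hf
  refine ⟨(fun g (v : κ → ℕ) => g (fun i => v (σ i))) '' F, hF.image _, ⟨f, hfF, rfl⟩, ?_⟩
  rintro _ ⟨g, hg, rfl⟩ r
  exact ⟨_, hcl g hg (fun i => r (σ i)), rfl⟩

theorem add_coords [Finite ι] {f : (ι → ℕ) → Δ} (hf : HasFiniteKernel k f) (σ τ : ι → κ) :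
    HasFiniteKernel k (fun v : κ → ℕ => f (fun i => v (σ i) + v (τ i))) := by
  obtain ⟨F, hF, hfF, hcl⟩ := hf
  -- The family is enlarged by carries: two digits below `k` plus a carry at most 1 produce a new
  -- carry at most 1.
  refine ⟨Set.image2 (fun g (c : ι → Fin 2) (v : κ → ℕ) =>
      g (fun i => v (σ i) + v (τ i) + c i)) F Set.univ, hF.image2 _ Set.finite_univ,
    ⟨f, hfF, fun _ => 0, trivial, by simp⟩, ?_⟩
  rintro _ ⟨g, hg, c, -, rfl⟩ r
  have hk : ∀ i, 0 < k := fun i => (r (σ i)).pos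
  have hlt : ∀ i, ((r (σ i) : ℕ) + r (τ i) + c i) / k < 2 := fun i => by
    rw [Nat.div_lt_iff_lt_mul (hk i)]
    have := (r (σ i)).isLt
    have := (r (τ i)).isLt
    have := (c i).isLt
    omega
  refine ⟨_, hcl g hg (fun i => ⟨((r (σ i) : ℕ) + r (τ i) + c i) % k, Nat.mod_lt _ (hk i)⟩),
    fun i => ⟨((r (σ i) : ℕ) + r (τ i) + c i) / k, hlt i⟩, trivial, ?_⟩
  funext v
  refine congrArg g (funext fun i => ?_)
  have := Nat.div_add_mod ((r (σ i) : ℕ) + r (τ i) + c i) k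
  simp only [Nat.mul_add]
  omega

/-- This is the subset construction: projecting away a coordinate means guessing its digits, so the
kernel is indexed by subsets of `F`, read as disjunctions. -/
theorem exists_nat (hk : 0 < k) {P : (ι → ℕ) → ℕ → Prop}
    (hP : HasFiniteKernel k (fun v : Option ι → ℕ => P (fun i => v (some i)) (v none))) :
    HasFiniteKernel k (fun v => ∃ m, P v m) := by
  obtain ⟨F, hF, hfF, hcl⟩ := hP
  let proj : Set ((Option ι → ℕ) → Prop) → (ι → ℕ) → Prop :=
    fun T v => ∃ Q ∈ T, ∃ m : ℕ, Q (fun o => o.elim m v)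
  refine ⟨proj '' {T | T ⊆ F}, hF.finite_subsets.image _,
    ⟨{fun v : Option ι → ℕ => P (fun i => v (some i)) (v none)}, by simpa using hfF, ?_⟩, ?_⟩
  · funext v
    simp [proj]
  rintro _ ⟨T, hT, rfl⟩ r
  refine ⟨{Q | ∃ Q' ∈ T, ∃ s : Fin k,
    Q = fun v => Q' (fun o => k * v o + (o.elim s r : Fin k))}, ?_, ?_⟩
  · rintro _ ⟨Q', hQ', s, rfl⟩
    exact hcl Q' (hT hQ') (fun o => o.elim s r)
  · funext v
    refine propext ⟨?_, ?_⟩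
    · rintro ⟨_, ⟨Q', hQ', s, rfl⟩, m, h⟩
      refine ⟨Q', hQ', k * m + s, ?_⟩
      convert h using 2 with o
      cases o <;> rfl
    · rintro ⟨Q', hQ', m, h⟩
      refine ⟨_, ⟨Q', hQ', ⟨m % k, Nat.mod_lt _ hk⟩, rfl⟩, m / k, ?_⟩
      convert h using 2 with o
      cases o
      · exact Nat.div_add_mod m k
      · rfl

theorem forall_nat (hk : 0 < k) {P : (ι → ℕ) → ℕ → Prop}
    (hP : HasFiniteKernel k (fun v : Option ι → ℕ => P (fun i => v (some i)) (v none))) :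
    HasFiniteKernel k (fun v => ∀ m, P v m) := by
  have := (exists_nat hk (P := fun v m => ¬ P v m) (hP.map Not)).map Not
  simpa using this

/-- Appending a digit to both sides either preserves the comparison or switches between strict and
weak, according to the order of the two digits. -/
theorem lt_fin_two : HasFiniteKernel k (fun u : Fin 2 → ℕ => u 0 < u 1) := by
  have key : ∀ a b r s : ℕ, r < k → s < k →
      (k * a + r < k * b + s ↔ a < b ∨ a = b ∧ r < s) := by
    intro a b r s hr hs
    rcases lt_trichotomy a b with h | h | h
    · have : k * (a + 1) ≤ k * b := Nat.mul_le_mul_left _ h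
      rw [Nat.mul_add] at this
      simp only [h, true_or, iff_true]
      omega
    · subst h; simp
    · have : k * (b + 1) ≤ k * a := Nat.mul_le_mul_left _ h
      rw [Nat.mul_add] at this
      constructor <;> intro <;> omega
  refine ⟨{fun u => u 0 < u 1, fun u => u 0 ≤ u 1}, by simp, by simp, ?_⟩
  rintro g (rfl | rfl) r
  · by_cases h : (r 0 : ℕ) < r 1
    · refine Or.inr (funext fun u => propext ?_)
      dsimp only
      rw [key _ _ _ _ (r 0).isLt (r 1).isLt]
      omega
    · refine Or.inl (funext fun u => propext ?_)
      dsimp only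
      rw [key _ _ _ _ (r 0).isLt (r 1).isLt]
      omega
  · by_cases h : (r 1 : ℕ) < r 0
    · refine Or.inl (funext fun u => propext ?_)
      dsimp only
      rw [← not_lt, key _ _ _ _ (r 1).isLt (r 0).isLt]
      omega
    · refine Or.inr (funext fun u => propext ?_)
      dsimp only
      rw [← not_lt, key _ _ _ _ (r 1).isLt (r 0).isLt]
      omega

theorem lt_coord (a b : ι) : HasFiniteKernel k (fun v : ι → ℕ => v a < v b) := by
  simpa using lt_fin_two.reindex (k := k) ![a, b]

theorem add_lt_add (a b c d : ι) :
    HasFiniteKernel k (fun v : ι → ℕ => v a + v b < v c + v d) := by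
  simpa using lt_fin_two.add_coords (k := k) ![a, c] ![b, d]

theorem rel_seq_add {x : ℕ → Δ} (hx : HasFiniteKernel k (fun u : Unit → ℕ => x (u ())))
    (R : Δ → Δ → Prop) (a b c d : ι) :
    HasFiniteKernel k (fun v : ι → ℕ => R (x (v a + v b)) (x (v c + v d))) :=
  (hx.add_coords (fun _ => a) (fun _ => b)).map₂ (hx.add_coords (fun _ => c) (fun _ => d)) R

end HasFiniteKernel

/-! ### Automata versus finite kernels. -/

theorem baseRep_zero (k : ℕ) (hk : 2 ≤ k) : baseRep k hk 0 = [] := by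
  simp [baseRep]

theorem baseRep_mul_add (k : ℕ) (hk : 2 ≤ k) (n : ℕ) (r : Fin k) (h : k * n + r ≠ 0) :
    baseRep k hk (k * n + r) = baseRep k hk n ++ [r] := by
  have hd : Nat.digits k (k * n + r) = (r : ℕ) :: Nat.digits k n := by
    rw [add_comm]
    refine Nat.digits_add k hk r n r.isLt ?_
    by_contra! h'
    simp [h'.1, h'.2] at h
  simp [baseRep, hd, List.pmap_append]

theorem IsAutomatic.hasFiniteKernel {k : ℕ} {hk : 2 ≤ k} {Δ : Type*} [Finite Δ] {x : ℕ → Δ}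
    (hx : IsAutomatic k hk x) : HasFiniteKernel k (fun u : Unit → ℕ => x (u ())) := by
  obtain ⟨σ, _, M, hM⟩ := hx
  let st : ℕ → σ := fun n => (baseRep k hk n).foldl M.step M.start
  have hst : ∀ n (r : Fin k), k * n + r ≠ 0 → st (k * n + r) = M.step (st n) r := fun n r h => by
    simp [st, baseRep_mul_add k hk n r h]
  have hst0 : st 0 = M.start := by simp [st, baseRep_zero]
  -- The automaton may react to leading zeros, so the value at 0 is stored separately from the
  -- function of the state.
  refine ⟨Set.range (fun (p : Δ × (σ → Δ)) (u : Unit → ℕ) =>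
    if u () = 0 then p.1 else p.2 (st (u ()))), Set.finite_range _, ⟨(M.out M.start, M.out), ?_⟩, ?_⟩
  · funext u
    have := hM (u ())
    by_cases h : u () = 0
    · simp only [h, if_true] at this ⊢
      rw [← this, DFAO.eval, baseRep_zero]
      rfl
    · simp only [h, if_false]
      exact this
  · rintro _ ⟨⟨d, g⟩, rfl⟩ r
    by_cases hr : (r () : ℕ) = 0
    · refine ⟨(d, fun s => g (M.step s (r ()))), ?_⟩
      funext u
      by_cases h : u () = 0
      · simp [h, hr]
      · have h1 : k * u () + (r () : ℕ) ≠ 0 := by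
          have : 0 < k * u () := Nat.mul_pos (by omega) (Nat.pos_of_ne_zero h)
          omega
        simp only [h, h1, if_false]
        rw [hst _ _ h1]
    · refine ⟨(g (M.step M.start (r ())), fun s => g (M.step s (r ()))), ?_⟩
      funext u
      have h1 : k * u () + (r () : ℕ) ≠ 0 := by omega
      simp only [h1, if_false]
      rw [hst _ _ h1]
      split_ifs with h
      · rw [h, hst0]
      · rfl

theorem HasFiniteKernel.isAutomatic {k : ℕ} (hk : 2 ≤ k) {Δ : Type} [Finite Δ] {x : ℕ → Δ}
    (hx : HasFiniteKernel k (fun u : Unit → ℕ => x (u ()))) : IsAutomatic k hk x := by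
  obtain ⟨F, hF, hxF, hcl⟩ := hx
  have := hF.to_subtype
  -- The state reached on `n` records the values at `n` of all members of the family.
  let M : DFAO k (F → Δ) Δ :=
    { step := fun s r f => s ⟨_, hcl f.1 f.2 (fun _ => r)⟩
      start := fun f => f.1 (fun _ => 0)
      out := fun s => s ⟨_, hxF⟩ }
  have key : ∀ n, (baseRep k hk n).foldl M.step M.start = fun f => f.1 (fun _ => n) := by
    intro n
    induction n using Nat.strong_induction_on with
    | _ n ih =>
      by_cases h0 : n = 0
      · simp [h0, baseRep_zero, M]
      · have hdm := Nat.div_add_mod n k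
        let r : Fin k := ⟨n % k, Nat.mod_lt _ (by omega)⟩
        have hn : n = k * (n / k) + r := hdm.symm
        have h := baseRep_mul_add k hk (n / k) r (by omega)
        rw [← hn] at h
        rw [h, List.foldl_append, ih _ (Nat.div_lt_self (by omega) hk)]
        funext f
        simp only [List.foldl_cons, List.foldl_nil, M]
        rw [← hn]
  exact ⟨F → Δ, inferInstance, M, fun n => by rw [DFAO.eval, key]⟩

theorem IsAutomatic.map {k : ℕ} {hk : 2 ≤ k} {Δ Δ' : Type*} {x : ℕ → Δ}
    (hx : IsAutomatic k hk x) (φ : Δ → Δ') : IsAutomatic k hk (fun n => φ (x n)) := by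
  obtain ⟨σ, hσ, M, hM⟩ := hx
  exact ⟨σ, hσ, ⟨M.step, M.start, fun s => φ (M.out s)⟩, fun n => congrArg φ (hM n)⟩

/-! ### Combinatorics of Lyndon words. -/

section Words
variable {α : Type*}

theorem exists_replicate_of_append_comm (s t : List α) (h : s ++ t = t ++ s) :
    ∃ (u : List α) (a b : ℕ), s = (List.replicate a u).flatten ∧
      t = (List.replicate b u).flatten := by
  induction hn : s.length + t.length using Nat.strong_induction_on generalizing s t with
  | _ n ih =>
    subst hn
    wlog hst : s.length ≤ t.length generalizing s t
    · obtain ⟨u, a, b, hs, ht⟩ := this t s h.symm (by rwa [add_comm]) (by omega)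
      exact ⟨u, b, a, ht, hs⟩
    by_cases hs : s = []
    · exact ⟨t, 0, 1, by simp [hs], by simp⟩
    · obtain ⟨t', rfl⟩ : s <+: t := List.prefix_of_prefix_length_le
        (List.prefix_append s t) (h ▸ List.prefix_append t s) hst
      have hpos := List.length_pos_iff.mpr hs
      obtain ⟨u, a, b, h1, h2⟩ := ih (s.length + t'.length) (by simp; omega) s t'
        (by simpa using h) rfl
      refine ⟨u, a, a + b, h1, ?_⟩
      rw [List.replicate_add, List.flatten_append, ← h1, ← h2]

theorem isPower_of_append_comm {s t : List α} (hs : s ≠ []) (ht : t ≠ [])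
    (h : s ++ t = t ++ s) : IsPower (s ++ t) := by
  obtain ⟨u, a, b, h1, h2⟩ := exists_replicate_of_append_comm s t h
  refine ⟨u, a + b, ?_, by rw [List.replicate_add, List.flatten_append, ← h1, ← h2]⟩
  have ha : a ≠ 0 := by rintro rfl; exact hs (by simpa using h1)
  have hb : b ≠ 0 := by rintro rfl; exact ht (by simpa using h2)
  omega

/-- Primitivity is what makes the inequalities strict: a nontrivial rotation equals the word exactly
when two commuting pieces make it a power. -/
theorem isLyndon_iff_lt_rotations [LinearOrder α] {w : List α} :
    IsLyndon w ↔ w ≠ [] ∧ ∀ s t : List α, s ≠ [] → t ≠ [] → w = s ++ t → w < t ++ s := by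
  constructor
  · rintro ⟨⟨hw, hp⟩, hmin⟩
    refine ⟨hw, ?_⟩
    rintro s t hs ht rfl
    refine lt_of_le_of_ne (hmin _ List.isRotated_append) fun h => ?_
    exact hp (isPower_of_append_comm hs ht h)
  · rintro ⟨hw, hlt⟩
    refine ⟨⟨hw, ?_⟩, ?_⟩
    · rintro ⟨u, m, hm, rfl⟩
      obtain ⟨m, rfl⟩ := Nat.exists_eq_add_of_le hm
      have hu : u ≠ [] := by
        rintro rfl
        exact hw (by simp)
      have h1 : (List.replicate (2 + m) u).flatten = u ++ (List.replicate (m + 1) u).flatten := by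
        rw [show 2 + m = 1 + (m + 1) by omega, List.replicate_add, List.flatten_append]
        simp
      have h2 : (List.replicate (2 + m) u).flatten = (List.replicate (m + 1) u).flatten ++ u := by
        rw [show 2 + m = (m + 1) + 1 by omega, List.replicate_add, List.flatten_append]
        simp
      have := hlt u (List.replicate (m + 1) u).flatten hu
        (by simp [List.replicate_succ, hu]) h1
      rw [← h2] at this
      exact lt_irrefl _ this
    · rintro v ⟨d, rfl⟩
      rw [← List.rotate_mod, List.rotate_eq_drop_append_take
        (Nat.mod_lt _ (List.length_pos_iff.mpr hw)).le]
      set e := d % w.length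
      by_cases h1 : w.take e = []
      · have := List.take_append_drop e w
        rw [h1] at this ⊢
        simp at this
        simp [this]
      by_cases h2 : w.drop e = []
      · have := List.take_append_drop e w
        rw [h2, List.append_nil] at this
        rw [h2, this]
        simp
      exact (hlt _ _ h1 h2 (List.take_append_drop e w).symm).le

theorem append_lt_append_of_length_eq [LinearOrder α] {p q : List α} (hl : p.length = q.length)
    (h : p < q) (a b : List α) : p ++ a < q ++ b := by
  rw [List.lt_iff_exists] at h ⊢
  rcases h with ⟨h1, h2⟩ | ⟨j, hj1, hj2, heq, hlt⟩
  · omega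
  · refine Or.inr ⟨j, by simp; omega, by simp; omega, ?_, ?_⟩
    · intro j' hj'
      rw [List.getElem_append_left (by omega), List.getElem_append_left (by omega)]
      exact heq j' hj'
    · rwa [List.getElem_append_left (by omega), List.getElem_append_left (by omega)]

/-- Comparing `b ++ s` with its rotation `b ++ p` gives `s < p`, while comparing `p ++ b` with `s ++
b` gives the opposite, as `s` and `p` have equal length. -/
theorem IsLyndon.unbordered [LinearOrder α] {w b s p : List α} (hw : IsLyndon w)
    (h1 : w = b ++ s) (h2 : w = p ++ b) (hb : b ≠ []) (hp : p ≠ []) : False := by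
  obtain ⟨-, hlt⟩ := isLyndon_iff_lt_rotations.mp hw
  have hl : p.length = s.length := by
    have := congrArg List.length (h1.symm.trans h2)
    simp at this
    omega
  have hs : s ≠ [] := by
    rintro rfl
    exact hp (List.length_eq_zero_iff.mp (by simpa using hl))
  have h3 := hlt p b hp hb h2
  have h4 := hlt b s hb hs h1
  rw [h1] at h3
  have h5 : s < p := by
    refine lt_of_not_ge fun h => ?_
    rcases h.lt_or_eq with h | h
    · have := h3.trans (List.append_left_lt (l₁ := b) h)
      exact lt_irrefl _ this
    · rw [h] at h3
      exact lt_irrefl _ h3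
  rw [h2] at h4
  exact lt_irrefl _ (h4.trans (append_lt_append_of_length_eq hl.symm h5 b b))

theorem length_factor (x : ℕ → α) (i n : ℕ) : (factor x i n).length = n := by
  simp [factor]

theorem getElem_factor (x : ℕ → α) (i n j : ℕ) (h : j < (factor x i n).length) :
    (factor x i n)[j] = x (i + j) := by
  simp [factor]

theorem factor_eq_iff {x : ℕ → α} {i j n : ℕ} :
    factor x i n = factor x j n ↔ ∀ t < n, x (i + t) = x (j + t) := by
  simp only [factor, List.ofFn_inj, funext_iff]
  exact ⟨fun h t ht => h ⟨t, ht⟩, fun h t => h t t.isLt⟩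

theorem factor_add (x : ℕ → α) (i m n : ℕ) :
    factor x i (m + n) = factor x i m ++ factor x (i + m) n := by
  refine List.ext_getElem (by simp [factor]) fun t h1 h2 => ?_
  rw [getElem_factor, List.getElem_append]
  split_ifs with h
  · rw [getElem_factor]
  · rw [getElem_factor, length_factor]
    rw [length_factor] at h
    congr 1
    omega

/-- This form avoids cyclic indices: the first mismatch with a rotation must fall inside the suffix
that starts at `a`, since otherwise that suffix would be a border. -/
theorem isLyndon_factor_iff [LinearOrder α] (x : ℕ → α) (i n : ℕ) :
    IsLyndon (factor x i n) ↔ 0 < n ∧ ∀ a, i < a → a < i + n →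
      ∃ j, a + j < i + n ∧ (∀ l < j, x (i + l) = x (a + l)) ∧ x (i + j) < x (a + j) := by
  constructor
  · intro hw
    have hn : 0 < n := by
      have := List.length_pos_iff.mpr hw.1.1
      rwa [length_factor] at this
    refine ⟨hn, fun a hia han => ?_⟩
    obtain ⟨d, rfl⟩ := Nat.exists_eq_add_of_lt hia
    obtain ⟨e, rfl⟩ : ∃ e, n = (d + 1) + e := ⟨n - (d + 1), by omega⟩
    have hlt := (isLyndon_iff_lt_rotations.mp hw).2 (factor x i (d + 1))
      (factor x (i + (d + 1)) e) (by simp [factor]) (by simp [factor]; omega)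
      (factor_add x i (d + 1) e)
    rw [List.lt_iff_exists] at hlt
    rcases hlt with ⟨-, h⟩ | ⟨j, hj1, hj2, heq, hlt⟩
    · simp [factor] at h
      omega
    have key : ∀ l < e, ∀ h, (factor x (i + (d + 1)) e ++ factor x i (d + 1))[l]'h =
        x (i + d + 1 + l) := by
      intro l hl h
      rw [List.getElem_append_left (by rwa [length_factor]), getElem_factor]
      congr 1
    by_cases hje : j < e
    · refine ⟨j, by omega, fun l hl => ?_, ?_⟩
      · have := heq l hl
        rwa [getElem_factor, key l (by omega)] at this
      · rwa [getElem_factor, key j hje] at hlt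
    · exfalso
      refine hw.unbordered (b := factor x i e) (s := factor x (i + e) (d + 1))
        (p := factor x i (d + 1)) ?_ ?_ (by simp [factor]; omega) (by simp [factor])
      · rw [add_comm (d + 1) e]
        exact factor_add x i e (d + 1)
      · rw [factor_add x i (d + 1) e]
        congr 1
        rw [factor_eq_iff]
        intro t ht
        have := heq t (by omega)
        rw [getElem_factor, key t ht] at this
        rw [this]
        congr 1
  · rintro ⟨hn, h⟩
    refine isLyndon_iff_lt_rotations.mpr ⟨by simp [factor]; omega, fun s t hs ht hw => ?_⟩
    have hlen := congrArg List.length hw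
    rw [length_factor, List.length_append] at hlen
    have hs' := List.length_pos_iff.mpr hs
    have ht' := List.length_pos_iff.mpr ht
    obtain ⟨j, hj, heq, hlt⟩ := h (i + s.length) (by omega) (by omega)
    have key : ∀ l, ∀ hl : l < t.length, t[l] = x (i + s.length + l) := by
      intro l hl
      have h1 : (factor x i n)[s.length + l]'(by rw [length_factor]; omega) = t[l] := by
        simp only [hw]
        rw [List.getElem_append_right (by omega)]
        simp
      rw [← h1, getElem_factor, add_assoc]
    rw [List.lt_iff_exists]
    refine Or.inr ⟨j, by rw [length_factor]; omega, by rw [List.length_append]; omega, ?_, ?_⟩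
    · intro l hl
      rw [getElem_factor, List.getElem_append_left (by omega), key]
      exact heq l hl
    · rw [getElem_factor, List.getElem_append_left (by omega), key]
      exact hlt

end Words

/-! ### Linear recurrence bounds the Lyndon complexity. -/

/-- An infinite word is linearly recurrent if, for some constant `R`, each of its factors of length
`n > 0` occurs in every window of length `R * n`. -/
def IsLinearlyRecurrent {α : Type*} (x : ℕ → α) : Prop :=
  ∃ R : ℕ, ∀ n, 0 < n → ∀ i j, ∃ s, j ≤ s ∧ s + n ≤ j + R * n ∧ factor x s n = factor x i n

theorem exists_least_factor {α : Type*} [LinearOrder α] [Finite α] (x : ℕ → α) (n : ℕ) :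
    ∃ i, ∀ j, factor x i n ≤ factor x j n := by
  have hfin : (Set.range fun i => factor x i n).Finite :=
    (List.finite_length_eq α n).subset (by rintro _ ⟨i, rfl⟩; exact length_factor x i n)
  obtain ⟨_, ⟨i, rfl⟩, hi⟩ := Set.exists_min_image _ id hfin ⟨_, 0, rfl⟩
  exact ⟨i, fun j => hi _ ⟨j, rfl⟩⟩

theorem IsLyndon.factor_le_factor {α : Type*} [LinearOrder α] {x : ℕ → α} {s n : ℕ}
    (h : IsLyndon (factor x s n)) {t l : ℕ} (hst : s ≤ t) (htl : t + l ≤ s + n) :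
    factor x s l ≤ factor x t l := by
  rcases hst.eq_or_lt with rfl | hst
  · exact le_rfl
  rcases Nat.eq_zero_or_pos l with rfl | hl
  · simp [factor]
  obtain ⟨j, -, heq, hlt⟩ := ((isLyndon_factor_iff x s n).mp h).2 t hst (by omega)
  by_cases hjl : j < l
  · refine le_of_lt (List.lt_iff_exists.mpr (Or.inr ⟨j, by rwa [length_factor],
      by rwa [length_factor], fun i hi => ?_, ?_⟩))
    · rw [getElem_factor, getElem_factor]
      exact heq i hi
    · rwa [getElem_factor, getElem_factor]
  · exact le_of_eq (factor_eq_iff.mpr fun i hi => heq i (by omega))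

theorem not_isLyndon_factor_of_periodic {α : Type*} [LinearOrder α] {x : ℕ → α} {d n : ℕ}
    (hd : 0 < d) (hdn : d < n) (hx : ∀ i, x i = x (i + d)) (s : ℕ) :
    ¬ IsLyndon (factor x s n) := by
  intro h
  obtain ⟨j, -, -, hlt⟩ := ((isLyndon_factor_iff x s n).mp h).2 (s + d) (by omega) (by omega)
  rw [hx (s + j), add_right_comm] at hlt
  exact lt_irrefl _ hlt

/-- Every Lyndon factor of length `n` contains, hence starts with, the least factor of length `n /
R`. Two such factors at a small distance `d` therefore force a long stretch of period `d`; by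
recurrence the whole word then has period `d`, which no longer Lyndon factor allows. -/
theorem lt_mul_sub_of_isLyndon_factor {α : Type*} [LinearOrder α] [Finite α] {x : ℕ → α} {R : ℕ}
    (hR : ∀ n, 0 < n → ∀ i j, ∃ s, j ≤ s ∧ s + n ≤ j + R * n ∧ factor x s n = factor x i n)
    {s t n : ℕ} (hst : s < t) (hs : IsLyndon (factor x s n)) (ht : IsLyndon (factor x t n)) :
    n < 2 * R ^ 2 * (t - s) := by
  have hR0 : 0 < R := by
    refine Nat.pos_of_ne_zero ?_
    rintro rfl
    obtain ⟨s, h1, h2, -⟩ := hR 1 one_pos 0 0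
    omega
  obtain ⟨d, hd0, rfl⟩ : ∃ d, 0 < d ∧ t = s + d := ⟨t - s, by omega, by omega⟩
  rw [Nat.add_sub_cancel_left]
  by_contra! hcon
  set l := n / R with hl
  have hRl : R * l ≤ n := Nat.mul_div_le n R
  -- The constant `2 * R ^ 2` arises here: `d + 1 ≤ 2 * d`, so `n` is at least `R ^ 2 * (d + 1)`.
  have hdl : R * (d + 1) ≤ l := by
    rw [hl, Nat.le_div_iff_mul_le hR0]
    nlinarith
  have hdl' : d + 1 ≤ l := by nlinarith
  have hln : l ≤ n := Nat.div_le_self n R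
  obtain ⟨i, hi⟩ := exists_least_factor x l
  have hstart : ∀ u, IsLyndon (factor x u n) → factor x u l = factor x i l := by
    intro u hu
    obtain ⟨v, huv, hvl, hv⟩ := hR l (by omega) i u
    refine le_antisymm ?_ (hi u)
    rw [← hv]
    exact hu.factor_le_factor huv (by omega)
  have heq := factor_eq_iff.mp ((hstart s hs).trans (hstart _ ht).symm)
  refine not_isLyndon_factor_of_periodic hd0 (by omega) (fun j => ?_) s hs
  obtain ⟨u, hsu, hud, hu⟩ := hR (d + 1) (by omega) j s
  rw [factor_eq_iff] at hu
  have h0 := hu 0 (by omega)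
  have hd := hu d (by omega)
  have h2 := heq (u - s) (by omega)
  rw [show s + (u - s) = u by omega, show s + d + (u - s) = u + d by omega] at h2
  rw [← hd, ← h2]
  exact h0.symm

theorem IsLinearlyRecurrent.exists_lyndonComplexity_le {α : Type*} [LinearOrder α] [Finite α]
    {x : ℕ → α} (hx : IsLinearlyRecurrent x) : ∃ b, ∀ n, lyndonComplexity x n ≤ b := by
  obtain ⟨R, hR⟩ := hx
  refine ⟨2 * R ^ 2 * R, fun n => ?_⟩
  rcases Nat.eq_zero_or_pos n with rfl | hn
  · rw [lyndonComplexity]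
    convert Nat.zero_le _
    rw [Set.ncard_eq_zero ((List.finite_length_eq α 0).subset _)]
    · refine Set.eq_empty_of_forall_notMem ?_
      rintro _ ⟨⟨i, rfl⟩, h⟩
      exact h.1.1 (by simp [factor])
    · rintro _ ⟨⟨i, rfl⟩, -⟩
      exact length_factor x i 0
  · set P : Set ℕ := {s | s < R * n ∧ IsLyndon (factor x s n)}
    have hPfin : P.Finite := (Set.finite_lt_nat (R * n)).subset fun s hs => hs.1
    have hsub : {w : List α | (∃ i, w = factor x i n) ∧ IsLyndon w} ⊆
        (fun s => factor x s n) '' P := by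
      rintro _ ⟨⟨i, rfl⟩, h⟩
      obtain ⟨s, -, hs, heq⟩ := hR n hn i 0
      exact ⟨s, ⟨by omega, heq ▸ h⟩, heq⟩
    refine (Set.ncard_le_ncard hsub (hPfin.image _)).trans ((Set.ncard_image_le hPfin).trans ?_)
    -- Distinct Lyndon positions are more than `n / (2 * R ^ 2)` apart, so they fall into distinct
    -- cells of that width.
    have hmono : StrictMonoOn (fun s => 2 * R ^ 2 * s / n) P := by
      intro s hs t ht hst
      have h := lt_mul_sub_of_isLyndon_factor hR hst hs.2 ht.2
      refine Nat.lt_of_succ_le ((Nat.le_div_iff_mul_le hn).mpr ?_)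
      have h1 : 2 * R ^ 2 * s / n * n ≤ 2 * R ^ 2 * s := Nat.div_mul_le_self _ _
      rw [Nat.mul_sub] at h
      rw [Nat.succ_mul]
      dsimp only
      omega
    have hmaps : ∀ s ∈ P, 2 * R ^ 2 * s / n ∈ Set.Iio (2 * R ^ 2 * R) := by
      intro s hs
      rw [Set.mem_Iio, Nat.div_lt_iff_lt_mul hn, mul_assoc _ R n]
      have hR0 : 0 < R := Nat.pos_of_ne_zero (by rintro rfl; simpa using hs.1)
      exact Nat.mul_lt_mul_of_pos_left hs.1 (by positivity)
    have := Set.ncard_le_ncard_of_injOn _ hmaps hmono.injOn (Set.finite_Iio _)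
    simpa [Set.ncard_eq_toFinset_card'] using this

/-! ### Definability and bounded counting. -/

section Kernel
variable {k : ℕ} {ι α : Type*} {x : ℕ → α}

theorem hasFiniteKernel_isLyndon_factor [LinearOrder α] (hk : 0 < k)
    (hx : HasFiniteKernel k (fun u : Unit → ℕ => x (u ()))) (a b : ι) :
    HasFiniteKernel k (fun v : ι → ℕ => IsLyndon (factor x (v a) (v b))) := by
  -- Bounds such as `c < v a + v b` get a dummy summand `m`, to fit the available comparison of two
  -- sums.
  have h : HasFiniteKernel k (fun v : ι → ℕ => (∃ m, m < v b) ∧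
      ∀ c, v a < c → (∃ m, c + m < v a + v b) → ∃ j, c + j < v a + v b ∧
        (∀ l, l < j → x (v a + l) = x (c + l)) ∧ x (v a + j) < x (c + j)) := by
    refine .map₂ (.exists_nat hk (.lt_coord _ _)) (.forall_nat hk ?_) And
    refine .map₂ (.lt_coord _ _) (.map₂ (.exists_nat hk (.add_lt_add _ _ _ _))
      (.exists_nat hk ?_) (· → ·)) (· → ·)
    refine .map₂ (.add_lt_add _ _ _ _) (.map₂ (.forall_nat hk ?_)
      (.rel_seq_add hx (· < ·) _ _ _ _) And) And
    exact .map₂ (.lt_coord _ _) (.rel_seq_add hx Eq _ _ _ _) (· → ·)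
  convert h using 2 with v
  rw [isLyndon_factor_iff]
  refine and_congr ⟨fun h => ⟨0, h⟩, fun ⟨m, hm⟩ => by omega⟩ (forall₂_congr fun c _ => ?_)
  exact imp_congr_left ⟨fun h => ⟨0, h⟩, fun ⟨m, hm⟩ => by omega⟩

theorem hasFiniteKernel_factor_ne (hk : 0 < k)
    (hx : HasFiniteKernel k (fun u : Unit → ℕ => x (u ()))) (a b c : ι) :
    HasFiniteKernel k (fun v : ι → ℕ => factor x (v a) (v c) ≠ factor x (v b) (v c)) := by
  have h : HasFiniteKernel k (fun v : ι → ℕ =>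
      ∃ j, j < v c ∧ x (v a + j) ≠ x (v b + j)) :=
    .exists_nat hk (.map₂ (.lt_coord _ _) (.rel_seq_add hx Ne _ _ _ _) And)
  convert h using 2 with v
  rw [Ne, factor_eq_iff]
  push Not
  rfl

/-- The position `i` is the first occurrence of a Lyndon factor of length `n`. -/
def IsFirstLyndon [LinearOrder α] (x : ℕ → α) (n i : ℕ) : Prop :=
  IsLyndon (factor x i n) ∧ ∀ j < i, factor x j n ≠ factor x i n

theorem hasFiniteKernel_isFirstLyndon [LinearOrder α] (hk : 0 < k)
    (hx : HasFiniteKernel k (fun u : Unit → ℕ => x (u ()))) (a b : ι) :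
    HasFiniteKernel k (fun v : ι → ℕ => IsFirstLyndon x (v a) (v b)) :=
  .map₂ (hasFiniteKernel_isLyndon_factor hk hx b a) (.forall_nat hk
    (.map₂ (.lt_coord _ _) (hasFiniteKernel_factor_ne hk hx _ _ _) (· → ·))) And

-- Taking `i` to be the last counted position lowers the threshold by one, at the cost of one
-- existential quantifier.
open Classical in
theorem le_count_succ_iff (S : ℕ → Prop) (c m : ℕ) :
    c + 1 ≤ Nat.count S m ↔ ∃ i, i < m ∧ S i ∧ c ≤ Nat.count S i := by
  constructor
  · intro h
    induction m with
    | zero => simp at h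
    | succ m ih =>
      by_cases hm : S m
      · rw [Nat.count_succ, if_pos hm] at h
        exact ⟨m, by omega, hm, by omega⟩
      · rw [Nat.count_succ, if_neg hm] at h
        obtain ⟨i, hi, h'⟩ := ih h
        exact ⟨i, by omega, h'⟩
  · rintro ⟨i, hi, hS, hc⟩
    have h1 : Nat.count S (i + 1) ≤ Nat.count S m := Nat.count_monotone S hi
    rw [Nat.count_succ, if_pos hS] at h1
    omega

open Classical in
theorem hasFiniteKernel_le_count (hk : 0 < k) {S : ℕ → ℕ → Prop}
    (hS : HasFiniteKernel k (fun u : Bool → ℕ => S (u false) (u true))) (c : ℕ) {ι : Type}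
    (a b : ι) : HasFiniteKernel k (fun v : ι → ℕ => c ≤ Nat.count (S (v a)) (v b)) := by
  induction c generalizing ι with
  | zero => simpa using (HasFiniteKernel.lt_coord (k := k) a b).map fun _ => True
  | succ c ih =>
    simp only [le_count_succ_iff]
    refine .exists_nat hk (.map₂ (.lt_coord _ _) (.map₂ ?_ (ih _ _) And) And)
    exact hS.reindex fun b => bif b then none else some a

open Classical in
theorem le_ncard_iff_exists_le_count {S : ℕ → Prop} (hS : {i | S i}.Finite) (c : ℕ) :
    c ≤ {i | S i}.ncard ↔ ∃ m, c ≤ Nat.count S m := by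
  have hcount : ∀ m, Nat.count S m = {i | i < m ∧ S i}.ncard := by
    intro m
    rw [Nat.count_eq_card_filter_range, ← Set.ncard_coe_finset]
    congr 1
    ext i
    simp
  constructor
  · intro h
    obtain ⟨m, hm⟩ := hS.bddAbove
    refine ⟨m + 1, h.trans ?_⟩
    rw [hcount]
    refine Set.ncard_le_ncard (fun i hi => ⟨Nat.lt_succ_of_le (hm hi), hi⟩)
      (hS.subset fun i hi => hi.2)
  · rintro ⟨m, hm⟩
    rw [hcount] at hm
    exact hm.trans (Set.ncard_le_ncard (fun i hi => hi.2) hS)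

theorem bijOn_isFirstLyndon [LinearOrder α] (x : ℕ → α) (n : ℕ) :
    Set.BijOn (fun i => factor x i n) {i | IsFirstLyndon x n i}
      {w | (∃ i, w = factor x i n) ∧ IsLyndon w} := by
  classical
  refine ⟨fun i hi => ⟨⟨i, rfl⟩, hi.1⟩, fun i hi j hj h => ?_, ?_⟩
  · rcases lt_trichotomy i j with hij | hij | hij
    · exact absurd h (hj.2 i hij)
    · exact hij
    · exact absurd h.symm (hi.2 j hij)
  · rintro w ⟨hw, hL⟩
    have hw' : ∃ i, factor x i n = w := hw.imp fun _ h => h.symm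
    refine ⟨Nat.find hw', ⟨?_, fun j hj h => ?_⟩, Nat.find_spec hw'⟩
    · rwa [Nat.find_spec hw']
    · exact Nat.find_min hw' hj (h.trans (Nat.find_spec hw'))

theorem isAutomatic_of_le {y : ℕ → ℕ} (hk : 2 ≤ k) {b : ℕ} (hb : ∀ n, y n ≤ b)
    (hy : ∀ c, HasFiniteKernel k (fun u : Unit → ℕ => c ≤ y (u ()))) : IsAutomatic k hk y := by
  -- The thresholds up to `b` determine `y n`, so `y` is a coding of `z`.
  let z : ℕ → Fin (b + 1) → Prop := fun n c => (c : ℕ) ≤ y n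
  have hz : IsAutomatic k hk z :=
    HasFiniteKernel.isAutomatic hk (.pi fun c : Fin (b + 1) => hy c)
  have hle : ∀ m n, z m = z n → y m ≤ y n := fun m n h =>
    (congrFun h ⟨y m, Nat.lt_succ_of_le (hb m)⟩).mp le_rfl
  have hfac : y.FactorsThrough z := fun m n h => le_antisymm (hle m n h) (hle n m h.symm)
  convert hz.map (Function.extend z y 0) using 2 with n
  exact (hfac.extend_apply 0 n).symm

theorem isAutomatic_lyndonComplexity [LinearOrder α] [Finite α] {hk : 2 ≤ k}
    (hx : IsAutomatic k hk x) (hrec : IsLinearlyRecurrent x) :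
    IsAutomatic k hk (lyndonComplexity x) := by
  classical
  obtain ⟨b, hb⟩ := hrec.exists_lyndonComplexity_le
  have hk0 : 0 < k := by omega
  refine isAutomatic_of_le hk hb fun c => ?_
  have h := HasFiniteKernel.exists_nat hk0 (P := fun (v : Unit → ℕ) m =>
    c ≤ Nat.count (IsFirstLyndon x (v ())) m)
    (hasFiniteKernel_le_count hk0
      (hasFiniteKernel_isFirstLyndon hk0 hx.hasFiniteKernel false true) c (some ()) none)
  convert h using 2 with v
  have hbij := bijOn_isFirstLyndon x (v ())
  have hfin : {i | IsFirstLyndon x (v ()) i}.Finite := by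
    refine Set.Finite.of_finite_image (f := fun i => factor x i (v ())) ?_ hbij.injOn
    rw [hbij.image_eq]
    refine (List.finite_length_eq α (v ())).subset ?_
    rintro _ ⟨⟨i, rfl⟩, -⟩
    exact length_factor x i _
  rw [← le_ncard_iff_exists_le_count hfin, lyndonComplexity, ← hbij.image_eq,
    hbij.injOn.ncard_image]

end Kernel

/-! ### Primitive morphic words are linearly recurrent. -/

section Morphisms
variable {A : Type*}

theorem infix_append_cases {w u v : List A} (h : w <:+: u ++ v) :
    w <:+: u ∨ w <:+: v ∨ ∃ s t, w = s ++ t ∧ s <:+ u ∧ t <+: v := by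
  obtain ⟨a, b, h⟩ := h
  rw [List.append_eq_append_iff] at h
  rcases h with ⟨c, h1, h2⟩ | ⟨c, h1, h2⟩
  · exact Or.inl ⟨a, c, h1.symm⟩
  · rw [List.append_eq_append_iff] at h1
    rcases h1 with ⟨d, h3, h4⟩ | ⟨d, h3, h4⟩
    · exact Or.inr (Or.inr ⟨d, c, h4, ⟨a, h3.symm⟩, ⟨b, h2.symm⟩⟩)
    · exact Or.inr (Or.inl ⟨d, b, by rw [h2, h4]⟩)

/-- A word no longer than any block straddles at most one block boundary. -/
theorem exists_infix_flatMap_of_le_length {g : A → List A} {n : ℕ} (hg : ∀ e, n ≤ (g e).length)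
    {w u : List A} (hw : w <:+: u.flatMap g) (hn : w.length ≤ n) :
    ∃ v, v <:+: u ∧ v.length ≤ 2 ∧ w <:+: v.flatMap g := by
  induction u with
  | nil => exact ⟨[], List.infix_rfl, by simp, by simpa using hw⟩
  | cons e u ih =>
    rw [List.flatMap_cons] at hw
    rcases infix_append_cases hw with h | h | ⟨s, t, rfl, hs, ht⟩
    · exact ⟨[e], ⟨[], u, rfl⟩, by simp, by simpa using h⟩
    · obtain ⟨v, h1, h2⟩ := ih h
      exact ⟨v, h1.trans (List.suffix_cons e u).isInfix, h2⟩
    · cases u with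
      | nil =>
        refine ⟨[e], List.infix_rfl, by simp, ?_⟩
        have : t = [] := by simpa using ht
        simpa [this] using hs.isInfix
      | cons e' u =>
        refine ⟨[e, e'], ⟨[], u, rfl⟩, by simp, ?_⟩
        rw [List.flatMap_cons] at ht
        have ht' : t <+: g e' := List.prefix_of_prefix_length_le ht (List.prefix_append _ _) (by
          have := hg e'
          rw [List.length_append] at hn
          omega)
        obtain ⟨a, ha⟩ := hs
        obtain ⟨b, hb⟩ := ht'
        exact ⟨a, b, by simp [← ha, ← hb]⟩

theorem exists_block_infix {g : A → List A} {n : ℕ} (hn : 0 < n) (hg : ∀ e, (g e).length ≤ n)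
    {w u : List A} (hw : w <:+: u.flatMap g) (hl : 2 * n ≤ w.length) : ∃ e, g e <:+: w := by
  induction u with
  | nil =>
    have : w = [] := by simpa using hw
    simp [this] at hl
    omega
  | cons e u ih =>
    rw [List.flatMap_cons] at hw
    rcases infix_append_cases hw with h | h | ⟨s, t, rfl, hs, ht⟩
    · have := h.length_le
      have := hg e
      omega
    · exact ih h
    · have h1 := hs.length_le
      have h2 := hg e
      rw [List.length_append] at hl
      cases u with
      | nil =>
        have : t = [] := by simpa using ht
        simp [this] at hl
        omega
      | cons e' u =>
        rw [List.flatMap_cons] at ht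
        have h3 := hg e'
        have : g e' <+: t := List.prefix_of_prefix_length_le (List.prefix_append _ _) ht (by omega)
        exact ⟨e', this.isInfix.trans (List.suffix_append s t).isInfix⟩

theorem infix_flatMap {u v : List A} (h : u <:+: v) (g : A → List A) :
    u.flatMap g <:+: v.flatMap g := by
  obtain ⟨a, b, rfl⟩ := h
  exact ⟨a.flatMap g, b.flatMap g, by simp⟩

variable {h : A → List A}

theorem iterate_morph_append (m : ℕ) (u v : List A) :
    (morph h)^[m] (u ++ v) = (morph h)^[m] u ++ (morph h)^[m] v := by
  induction m generalizing u v with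
  | zero => rfl
  | succ m ih => rw [Function.iterate_succ_apply, morph, List.flatMap_append, ih]; rfl

theorem iterate_morph_eq_flatMap (m : ℕ) (u : List A) :
    (morph h)^[m] u = u.flatMap (fun b => (morph h)^[m] [b]) := by
  induction u with
  | nil => induction m with
    | zero => rfl
    | succ m ih => rw [Function.iterate_succ_apply]; exact ih
  | cons b u ih => rw [← List.singleton_append, iterate_morph_append, ih]; rfl

theorem iterate_morph_add (m l : ℕ) (u : List A) :
    (morph h)^[m + l] u = ((morph h)^[l] u).flatMap (fun b => (morph h)^[m] [b]) := by
  rw [Function.iterate_add_apply, iterate_morph_eq_flatMap]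

theorem iterate_morph_infix {p : ℕ} (hp : ∀ a b : A, b ∈ (morph h)^[p] [a]) (m : ℕ) (a b : A) :
    (morph h)^[m] [b] <:+: (morph h)^[m + p] [a] := by
  rw [iterate_morph_add]
  obtain ⟨s, t, hst⟩ := List.append_of_mem (hp a b)
  have := infix_flatMap (u := [b]) (v := (morph h)^[p] [a]) ⟨s, t, by simp [hst]⟩ (fun b => (morph h)^[m] [b])
  simpa using this

theorem length_flatMap_le {g : A → List A} {n : ℕ} (hg : ∀ e, (g e).length ≤ n) (u : List A) :
    (u.flatMap g).length ≤ n * u.length := by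
  induction u with
  | nil => simp
  | cons e u ih =>
    have := hg e
    rw [List.flatMap_cons, List.length_append, List.length_cons, Nat.mul_succ]
    omega

/-- By primitivity `h^m(b)` sits inside `h^(m+p)(c)`, so all letters have images of comparable
length at each level, and `N` more steps cost a bounded factor. -/
theorem exists_length_iterate_morph_le [Finite A] (hh : IsPrimitiveMorphism h) (N : ℕ) :
    ∃ K, ∀ m (b c : A), ((morph h)^[m + N] [b]).length ≤ K * ((morph h)^[m] [c]).length := by
  obtain ⟨p, -, hp⟩ := hh
  have hbd : ∀ N, ∃ L, ∀ e : A, ((morph h)^[N] [e]).length ≤ L := fun N => by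
    obtain ⟨L, hL⟩ := (Set.finite_range fun e : A => ((morph h)^[N] [e]).length).bddAbove
    exact ⟨L, fun e => hL ⟨e, rfl⟩⟩
  obtain ⟨L, hL⟩ := hbd N
  obtain ⟨C, hC⟩ := hbd p
  refine ⟨L * C, fun m b c => ?_⟩
  have h1 : ((morph h)^[m] [b]).length ≤ C * ((morph h)^[m] [c]).length := by
    refine (iterate_morph_infix hp m c b).length_le.trans ?_
    rw [add_comm, iterate_morph_add]
    exact length_flatMap_le hC _
  rw [add_comm, iterate_morph_add, mul_assoc]
  exact (length_flatMap_le hL _).trans (Nat.mul_le_mul_left _ h1)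

theorem IsProlongable.iterate_prefix {a : A} (ha : IsProlongable h a) {r s : ℕ} (hrs : r ≤ s) :
    (morph h)^[r] [a] <+: (morph h)^[s] [a] := by
  obtain ⟨u, hu, -⟩ := ha
  induction s, hrs using Nat.le_induction with
  | base => exact List.prefix_rfl
  | succ s _ ih =>
    refine ih.trans ⟨(morph h)^[s] u, ?_⟩
    rw [Function.iterate_succ_apply, ← iterate_morph_append]
    simp [morph, hu]

theorem IsProlongable.lt_length {a : A} (ha : IsProlongable h a) (r : ℕ) :
    r < ((morph h)^[r] [a]).length := by
  obtain ⟨u, hu, hne⟩ := ha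
  induction r with
  | zero => simp
  | succ r ih =>
    have h1 : (morph h)^[r + 1] [a] = (morph h)^[r] [a] ++ (morph h)^[r] u := by
      rw [Function.iterate_succ_apply, ← iterate_morph_append]
      simp [morph, hu]
    have := List.length_pos_iff.mpr (hne r)
    rw [h1, List.length_append]
    omega

theorem IsLimit.eventually_factor_infix {w : ℕ → List A} {y : ℕ → A} (hy : IsLimit w y)
    (i n : ℕ) : ∀ᶠ t in Filter.atTop, factor y i n <:+: w t := by
  have : ∀ᶠ t in Filter.atTop, ∀ l ∈ Set.Iio (i + n), (w t)[l]? = some (y l) :=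
    (Filter.eventually_all_finite (Set.finite_Iio _)).mpr fun l _ => hy l
  filter_upwards [this] with t ht
  have h1 : factor y 0 (i + n) <+: w t := by
    rw [List.prefix_iff_getElem?]
    intro l hl
    rw [getElem_factor, zero_add]
    rw [length_factor] at hl
    exact ht l hl
  rw [factor_add, zero_add] at h1
  exact (List.suffix_append _ _).isInfix.trans h1.isInfix

theorem factor_of_infix_factor {x : ℕ → A} {j l : ℕ} {w : List A} (hw : w <:+: factor x j l) :
    ∃ s, j ≤ s ∧ s + w.length ≤ j + l ∧ factor x s w.length = w := by
  obtain ⟨a, b, hab⟩ := hw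
  have hl := congrArg List.length hab
  simp only [List.length_append, length_factor] at hl
  refine ⟨j + a.length, by omega, by omega, ?_⟩
  rw [← hl, factor_add, factor_add] at hab
  exact (List.append_inj (List.append_inj hab (by simp [length_factor])).1
    (by simp [length_factor])).2.symm

/-- At the first level `m` where all blocks have length at least `n`, a factor of length `n` lies in
the image of at most two adjacent letters. Such pairs are finitely many and occur in every `h^N(e)`,
so the factor occurs in every `h^(m+N)(e)`; by minimality of `m` these blocks have length `O(n)`. -/
theorem isLinearlyRecurrent_of_isLimit [Finite A] {a : A} {y : ℕ → A}
    (hh : IsPrimitiveMorphism h) (ha : IsProlongable h a)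
    (hy : IsLimit (fun n => (morph h)^[n] [a]) y) : IsLinearlyRecurrent y := by
  obtain ⟨p, -, hp⟩ := id hh
  obtain ⟨M, hM⟩ : ∃ M, ∀ v : List A, v.length ≤ 2 → (∃ s, v <:+: (morph h)^[s] [a]) →
      v <:+: (morph h)^[M] [a] := by
    have : ∀ᶠ M in Filter.atTop, ∀ v ∈ {v : List A | v.length ≤ 2},
        (∃ s, v <:+: (morph h)^[s] [a]) → v <:+: (morph h)^[M] [a] := by
      refine (Filter.eventually_all_finite (List.finite_length_le A 2)).mpr fun v _ => ?_
      by_cases hv : ∃ s, v <:+: (morph h)^[s] [a]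
      · obtain ⟨s, hs⟩ := hv
        filter_upwards [Filter.eventually_ge_atTop s] with M hM _
        exact hs.trans (ha.iterate_prefix hM).isInfix
      · exact Filter.Eventually.of_forall fun _ h => absurd h hv
    exact this.exists
  set N := M + p
  obtain ⟨K₀, hK₀⟩ := exists_length_iterate_morph_le hh N
  obtain ⟨K₁, hK₁⟩ := exists_length_iterate_morph_le hh (1 + N)
  -- `K₀` serves level 0, `K₁` a positive level via its predecessor, and 1 keeps the bound positive;
  -- a window of twice the block bound contains a whole block.
  refine ⟨2 * (K₀ + K₁ + 1), fun n hn i j => ?_⟩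
  obtain ⟨m, hm1, hm2⟩ : ∃ m, (∀ e : A, n ≤ ((morph h)^[m] [e]).length) ∧
      ∀ e : A, ((morph h)^[m + N] [e]).length ≤ (K₀ + K₁ + 1) * n := by
    classical
    have hex : ∃ m, ∀ e : A, n ≤ ((morph h)^[m] [e]).length :=
      ⟨n + p, fun e => (ha.lt_length n).le.trans (iterate_morph_infix hp n e a).length_le⟩
    refine ⟨Nat.find hex, Nat.find_spec hex, fun e => ?_⟩
    rcases hm : Nat.find hex with _ | m
    · have h1 := hK₀ 0 e e
      have h2 : ((morph h)^[0] [e]).length = 1 := rfl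
      rw [h2, mul_one] at h1
      nlinarith
    · have h1 := Nat.find_min hex (m := m) (by omega)
      push Not at h1
      obtain ⟨c, hc⟩ := h1
      have h2 := hK₁ m e c
      rw [← add_assoc] at h2
      nlinarith
  have hfac : ∀ e : A, factor y i n <:+: (morph h)^[m + N] [e] := by
    intro e
    obtain ⟨t, ht, hmt⟩ :=
      ((hy.eventually_factor_infix i n).and (Filter.eventually_ge_atTop m)).exists
    obtain ⟨t, rfl⟩ := Nat.exists_eq_add_of_le hmt
    rw [iterate_morph_add] at ht
    obtain ⟨v, hv1, hv2, hv3⟩ :=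
      exists_infix_flatMap_of_le_length hm1 ht (length_factor y i n).le
    rw [iterate_morph_add]
    exact hv3.trans (infix_flatMap
      ((hM v hv2 ⟨t, hv1⟩).trans (iterate_morph_infix hp M e a)) _)
  set L := (K₀ + K₁ + 1) * n
  obtain ⟨t, ht, hmt⟩ := ((hy.eventually_factor_infix j (2 * L)).and
    (Filter.eventually_ge_atTop (m + N))).exists
  obtain ⟨t, rfl⟩ := Nat.exists_eq_add_of_le hmt
  rw [iterate_morph_add] at ht
  obtain ⟨e, he⟩ := exists_block_infix (by positivity) hm2 ht (length_factor y j (2 * L)).ge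
  obtain ⟨s, h1, h2, h3⟩ := factor_of_infix_factor ((hfac e).trans he)
  rw [length_factor] at h2 h3
  exact ⟨s, h1, by rwa [mul_assoc], h3⟩

theorem IsPrimitiveMorphic.isLinearlyRecurrent {B : Type*} {x : ℕ → B}
    (hx : IsPrimitiveMorphic x) : IsLinearlyRecurrent x := by
  obtain ⟨A, _, h, a, τ, y, hh, ha, hy, hxy⟩ := hx
  obtain ⟨R, hR⟩ := isLinearlyRecurrent_of_isLimit hh ha hy
  refine ⟨R, fun n hn i j => ?_⟩
  obtain ⟨s, h1, h2, h3⟩ := hR n hn i j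
  refine ⟨s, h1, h2, factor_eq_iff.mpr fun t ht => ?_⟩
  rw [hxy, hxy, factor_eq_iff.mp h3 t ht]

end Morphisms
end Word

theorem corollary26 {α : Type*} [LinearOrder α] [Finite α] (k : ℕ) (hk : 2 ≤ k) (x : ℕ → α)
    (hauto : Word.IsAutomatic k hk x) (hmorph : Word.IsPrimitiveMorphic x) :
    Word.IsAutomatic k hk (Word.lyndonComplexity x) := by
  exact Word.isAutomatic_lyndonComplexity hauto hmorph.isLinearlyRecurrent
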